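/- Let $N\ge 2$, $Q_\infty=\mathbb R^N\times(0,\infty)$, and let $f:[0,\infty)\to[0,\infty)$ be continuous, nondecreasing, positive on $(0,\infty)$, with $f(0)=0$ and $\lim_{s\to\infty}f(s)=\infty$. Assume (C1) the function $s\mapsto f(s)/s$ is increasing (in the wide sense, i.e. nondecreasing) on $(0,\infty)$, $\lim_{s\to0^+}f(s)/s=0$ and $\lim_{s\to\infty}f(s)/s=\infty$; and that the Keller–Osserman integral diverges: $$\int_1^\infty\frac{ds}{\sqrt{F(s)}}=\infty,\qquad F(s)=\int_0^s f(\sigma)\,d\sigma .$$ For $\varepsilon>0$ let $w_\varepsilon\in C^2([0,\infty))$ be the (unique) positive solution of $$-w''-\frac{N-1}{r}w'+f(w)=0\ \text{ in }(0,\infty),\qquad w'(0)=0,\qquad w(0)=\varepsilon .$$ Let $u,\tilde u\in C(\overline{Q_\infty})\cap C^{2,1}(Q_\infty)$ be two solutions of $$\partial_t u-\Delta u+f(u)=0\quad\text{in }Q_\infty,$$ positive in $Q_\infty$, with the same initial data: $u(x,0)=\tilde u(x,0)=u_0(x)$ for all $x\in\mathbb R^N$. Suppose that for every $\varepsilon>0$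 $$u(x,t)-\tilde u(x,t)=o(w_\varepsilon(|x|))\quad\text{as }|x|\to\infty,$$ locally uniformly with respect to $t\ge0$; that is, for all $\varepsilon,T,\delta>0$ there is $R$ such that $|u(x,t)-\tilde u(x,t)|\le\delta\,w_\varepsilon(|x|)$ whenever $|x|\ge R$ and $0\le t\le T$. Then $u=\tilde u$ in $\overline{Q_\infty}$. -/

import Mathlib

open Set Filter Topology MeasureTheory
open scoped Laplacian ENNReal

noncomputable section

/-- The Euclidean space `ℝ^N`. -/
abbrev Space (N : ℕ) : Type := EuclideanSpace ℝ (Fin N)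

/-- The standing assumptions on the absorption term `f : [0,∞) → [0,∞)`. The function is given on
the whole line, but only its values on `[0,∞)` are ever used. -/
structure IsAbsorption (f : ℝ → ℝ) : Prop where
  continuousOn : ContinuousOn f (Ici 0)
  monotoneOn : MonotoneOn f (Ici 0)
  zero : f 0 = 0
  pos : ∀ s, 0 < s → 0 < f s
  tendsto : Tendsto f atTop atTop

/-- Condition (C1): `f(s)/s` is increasing (in the wide sense) on `(0,∞)`, tends to `0` at `0` and
to `∞` at `∞`. -/
structure ConditionC1 (f : ℝ → ℝ) : Prop where
  monotoneOn : MonotoneOn (fun s => f s / s) (Ioi 0)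
  tendsto_zero : Tendsto (fun s => f s / s) (𝓝[>] 0) (𝓝 0)
  tendsto_top : Tendsto (fun s => f s / s) atTop atTop

/-- The primitive `F(s) = ∫₀ˢ f(σ) dσ`. -/
def primitive (f : ℝ → ℝ) (s : ℝ) : ℝ := ∫ σ in (0 : ℝ)..s, f σ

/-- Divergence of the Keller–Osserman integral: `∫₁^∞ ds / √F(s) = ∞`. -/
def KellerOssermanDiverges (f : ℝ → ℝ) : Prop :=
  ∫⁻ s in Ioi (1 : ℝ), ENNReal.ofReal (1 / Real.sqrt (primitive f s)) = ⊤

/-- `w` is a positive `C²([0,∞))` solution of `-w'' - (N-1)/r w' + f(w) = 0` in `(0,∞)` with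
`w'(0) = 0` and `w(0) = a`. Derivatives at `0` are one-sided. -/
structure IsRadialSolution (N : ℕ) (f : ℝ → ℝ) (a : ℝ) (w : ℝ → ℝ) : Prop where
  contDiffOn : ContDiffOn ℝ 2 w (Ici 0)
  pos : ∀ r, 0 ≤ r → 0 < w r
  equation : ∀ r, 0 < r → -deriv (deriv w) r - ((N : ℝ) - 1) / r * deriv w r + f (w r) = 0
  deriv_zero : derivWithin w (Ici 0) 0 = 0
  value_zero : w 0 = a

/-- `u ∈ C^{2,1}(Q_∞)`, `Q_∞ = ℝ^N × (0,∞)`: the derivatives of `u` of order at most two in `x` and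
of order one in `t` exist and are continuous functions of `(x,t)` on `Q_∞`. -/
structure IsC21 (N : ℕ) (u : Space N → ℝ → ℝ) : Prop where
  contDiff_space : ∀ t, 0 < t → ContDiff ℝ 2 (fun x => u x t)
  differentiableAt_time : ∀ x t, 0 < t → DifferentiableAt ℝ (fun s => u x s) t
  continuousOn : ContinuousOn (fun p : Space N × ℝ => u p.1 p.2) {p | 0 < p.2}
  continuousOn_time : ContinuousOn
    (fun p : Space N × ℝ => deriv (fun s => u p.1 s) p.2) {p | 0 < p.2}
  continuousOn_fderiv : ContinuousOn
    (fun p : Space N × ℝ => fderiv ℝ (fun x => u x p.2) p.1) {p | 0 < p.2}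
  continuousOn_fderiv_two : ContinuousOn
    (fun p : Space N × ℝ => iteratedFDeriv ℝ 2 (fun x => u x p.2) p.1) {p | 0 < p.2}

/-- `u` is a positive solution, of class `C(closure Q_∞) ∩ C^{2,1}(Q_∞)`, of
`∂ₜu - Δu + f(u) = 0` in `Q_∞` with initial data `u₀`. -/
structure IsPositiveSolution (N : ℕ) (f : ℝ → ℝ) (u₀ : Space N → ℝ) (u : Space N → ℝ → ℝ) :
    Prop where
  continuousOn_closure : ContinuousOn (fun p : Space N × ℝ => u p.1 p.2) {p | 0 ≤ p.2}
  isC21 : IsC21 N u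
  pos : ∀ x t, 0 < t → 0 < u x t
  equation : ∀ x t, 0 < t → deriv (fun s => u x s) t - Δ (fun y => u y t) x + f (u x t) = 0
  initial : ∀ x, u x 0 = u₀ x

/-- `v(x,t) = o(w(|x|))` as `|x| → ∞`, locally uniformly with respect to `t ≥ 0`. -/
def IsLittleOLocallyUniformly (N : ℕ) (v : Space N → ℝ → ℝ) (w : ℝ → ℝ) : Prop :=
  ∀ T : ℝ, 0 < T → ∀ δ : ℝ, 0 < δ → ∃ R : ℝ, ∀ x : Space N, R ≤ ‖x‖ →
    ∀ t ∈ Icc (0 : ℝ) T, |v x t| ≤ δ * |w ‖x‖|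

end

/-! By (C1), f is superadditive, so wherever u > v the difference u - v satisfies ∂ₜ(u - v) - Δ(u -
v) + f(u - v) ≤ 0. A radial solution w of Δw = f(w) with w(0) = a is a stationary solution of the
equation, and by hypothesis it dominates u - v at infinity. The maximum principle on a large
cylinder gives u - v ≤ w(|x|) (`sub_le_of_isLittleO`), and by symmetry |u - v| ≤ w(|x|). It remains
to let a → 0.

Both the existence of w and its smallness rest on one energy estimate (`travelTime_le`): w'' ≤ f(w)
gives w'² ≤ 2F(w), so w cannot reach a level s before r = ∫ₐˢ dσ/√(2F(σ)). This integral diverges as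
s → ∞ by Keller–Osserman, which bounds the monotone iteration for w on compact sets
(`exists_radialLift_fixedPoint`). For fixed s it diverges as a → 0, because (C1) gives F(σ) ≤ Cσ²
near 0 (`exists_pos_lt_travelTime`); hence w(|x|) → 0 at each fixed x. -/

/-! ### The radial Poisson equation in integral form. -/

/-- The weighted mean `∫₀¹ τ^(N-1) g(rτ) dτ`; `r` times it is `r^(1-N) ∫₀ʳ σ^(N-1) g(σ) dσ`. -/
noncomputable def radialMean (N : ℕ) (g : ℝ → ℝ) (r : ℝ) : ℝ :=
  ∫ τ in (0 : ℝ)..1, τ ^ (N - 1) * g (r * τ)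

/-- The radial function with value `a` at the origin and Laplacian `g`. -/
noncomputable def radialLift (N : ℕ) (a : ℝ) (g : ℝ → ℝ) (r : ℝ) : ℝ :=
  a + ∫ s in (0 : ℝ)..r, s * radialMean N g s

section RadialMean

variable {N : ℕ} {a : ℝ} {g g' : ℝ → ℝ}

theorem continuous_radialMean (N : ℕ) (hg : Continuous g) : Continuous (radialMean N g) := by
  unfold radialMean
  apply intervalIntegral.continuous_parametric_intervalIntegral_of_continuous'
  simp only [Function.uncurry_def]
  fun_prop

theorem radialMean_zero (hN : 1 ≤ N) : radialMean N g 0 = g 0 / N := by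
  have h : ((N - 1 : ℕ) : ℝ) + 1 = N := by
    rw [Nat.cast_sub hN]; simp
  have h0 : N - 1 + 1 = N := by omega
  simp only [radialMean, zero_mul, intervalIntegral.integral_mul_const, integral_pow, h, h0,
    one_pow]
  rw [zero_pow (by omega)]
  ring

theorem pow_mul_radialMean (hN : 1 ≤ N) (r : ℝ) :
    r ^ N * radialMean N g r = ∫ σ in (0 : ℝ)..r, σ ^ (N - 1) * g σ := by
  have h := intervalIntegral.mul_integral_comp_mul_left (a := 0) (b := 1)
    (f := fun σ => σ ^ (N - 1) * g σ) r
  simp only [mul_zero, mul_one] at h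
  rw [← h]
  obtain ⟨k, rfl⟩ : ∃ k, N = k + 1 := ⟨N - 1, by omega⟩
  simp only [radialMean, Nat.add_sub_cancel, mul_pow, mul_assoc,
    intervalIntegral.integral_const_mul]
  ring

theorem hasDerivAt_radialLift (hg : Continuous g) (r : ℝ) :
    HasDerivAt (radialLift N a g) (r * radialMean N g r) r := by
  have hc : Continuous fun s => s * radialMean N g s :=
    continuous_id.mul (continuous_radialMean N hg)
  exact (hc.integral_hasStrictDerivAt 0 r).hasDerivAt.const_add a

theorem hasDerivAt_radialMean (hN : 1 ≤ N) (hg : Continuous g) {r : ℝ} (hr : r ≠ 0) :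
    HasDerivAt (radialMean N g) ((g r - N * radialMean N g r) / r) r := by
  have hc : Continuous fun σ => σ ^ (N - 1) * g σ := by fun_prop
  have h1 : HasDerivAt (fun r => (∫ σ in (0 : ℝ)..r, σ ^ (N - 1) * g σ) / r ^ N) _ r :=
    (hc.integral_hasStrictDerivAt 0 r).hasDerivAt.div (hasDerivAt_pow N r) (pow_ne_zero N hr)
  have h2 : radialMean N g =ᶠ[𝓝 r]
      fun r => (∫ σ in (0 : ℝ)..r, σ ^ (N - 1) * g σ) / r ^ N := by
    filter_upwards [isOpen_ne.mem_nhds hr] with s hs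
    rw [← pow_mul_radialMean hN, mul_div_cancel_left₀ _ (pow_ne_zero N hs)]
  refine (h1.congr_of_eventuallyEq h2).congr_deriv ?_
  rw [← pow_mul_radialMean hN]
  obtain ⟨k, rfl⟩ : ∃ k, N = k + 1 := ⟨N - 1, by omega⟩
  simp only [Nat.add_sub_cancel]
  field_simp
  ring

/-- The quotient form of the mean is singular at the origin, but there the difference quotient of
the product is the mean itself. This makes `radialLift` of class C² across 0. -/
theorem hasDerivAt_mul_radialMean (hN : 1 ≤ N) (hg : Continuous g) (r : ℝ) :
    HasDerivAt (fun r => r * radialMean N g r) (g r - (N - 1) * radialMean N g r) r := by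
  rcases eq_or_ne r 0 with rfl | hr
  · have hN0 : (N : ℝ) ≠ 0 := by positivity
    have h : g 0 - (N - 1) * radialMean N g 0 = radialMean N g 0 := by
      rw [radialMean_zero hN]; field_simp; ring
    rw [h, hasDerivAt_iff_tendsto_slope]
    refine (((continuous_radialMean N hg).tendsto 0).mono_left nhdsWithin_le_nhds).congr' ?_
    filter_upwards [self_mem_nhdsWithin] with s hs
    rw [slope_def_field]
    have hs' : s ≠ 0 := hs
    field_simp
    ring
  · refine ((hasDerivAt_id r).mul (hasDerivAt_radialMean hN hg hr)).congr_deriv ?_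
    simp only [id]
    field_simp
    ring

theorem continuous_radialLift (hg : Continuous g) : Continuous (radialLift N a g) :=
  continuous_iff_continuousAt.2 fun r => (hasDerivAt_radialLift hg r).continuousAt

theorem contDiff_radialLift (hN : 1 ≤ N) (hg : Continuous g) :
    ContDiff ℝ 2 (radialLift N a g) := by
  have h1 : deriv (radialLift N a g) = fun r => r * radialMean N g r :=
    funext fun r => (hasDerivAt_radialLift hg r).deriv
  have h2 : deriv (fun r => r * radialMean N g r) = fun r => g r - (N - 1) * radialMean N g r :=
    funext fun r => (hasDerivAt_mul_radialMean hN hg r).deriv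
  rw [show (2 : WithTop ℕ∞) = 1 + 1 by norm_num, contDiff_succ_iff_deriv, h1, contDiff_one_iff_deriv,
    h2]
  have := continuous_radialMean N hg
  exact ⟨fun r => (hasDerivAt_radialLift hg r).differentiableAt, by simp,
    fun r => (hasDerivAt_mul_radialMean hN hg r).differentiableAt, by fun_prop⟩

theorem radialMean_mono (hg : Continuous g) (hg' : Continuous g') (h : g ≤ g') (r : ℝ) :
    radialMean N g r ≤ radialMean N g' r := by
  apply intervalIntegral.integral_mono_on zero_le_one
  · exact Continuous.intervalIntegrable (by fun_prop) _ _
  · exact Continuous.intervalIntegrable (by fun_prop) _ _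
  · intro τ hτ
    exact mul_le_mul_of_nonneg_left (h _) (pow_nonneg hτ.1 _)

theorem radialMean_nonneg (h : 0 ≤ g) (r : ℝ) : 0 ≤ radialMean N g r :=
  intervalIntegral.integral_nonneg zero_le_one fun _ hτ =>
    mul_nonneg (pow_nonneg hτ.1 _) (h _)

theorem radialMean_neg (h : ∀ r, g (-r) = g r) (r : ℝ) :
    radialMean N g (-r) = radialMean N g r := by
  simp only [radialMean, neg_mul, h]

theorem radialLift_neg (h : ∀ r, g (-r) = g r) (r : ℝ) :
    radialLift N a g (-r) = radialLift N a g r := by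
  have h1 := intervalIntegral.integral_comp_neg (a := 0) (b := r)
    (fun s => s * radialMean N g s)
  simp only [radialMean_neg h, neg_mul, neg_zero, intervalIntegral.integral_neg] at h1
  rw [radialLift, radialLift, intervalIntegral.integral_symm, ← h1, neg_neg]

theorem radialLift_zero : radialLift N a g 0 = a := by simp [radialLift]

theorem le_radialLift (h : 0 ≤ g) {r : ℝ} (hr : 0 ≤ r) : a ≤ radialLift N a g r :=
  le_add_of_nonneg_right <| intervalIntegral.integral_nonneg hr fun s hs =>
    mul_nonneg hs.1 (radialMean_nonneg h s)

theorem radialLift_mono (hg : Continuous g) (hg' : Continuous g') (h : g ≤ g') {r : ℝ}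
    (hr : 0 ≤ r) : radialLift N a g r ≤ radialLift N a g' r := by
  refine add_le_add_right (intervalIntegral.integral_mono_on hr ?_ ?_ fun s hs =>
    mul_le_mul_of_nonneg_left (radialMean_mono hg hg' h s) hs.1) _
  · exact (continuous_id.mul (continuous_radialMean N hg)).intervalIntegrable _ _
  · exact (continuous_id.mul (continuous_radialMean N hg')).intervalIntegrable _ _

/-- The pointwise bound on the integrand is kept for use in dominated convergence. -/
theorem abs_radialMean_le {r B : ℝ} (hB : ∀ s, |s| ≤ |r| → |g s| ≤ B) :
    |radialMean N g r| ≤ B ∧ ∀ τ ∈ uIoc (0 : ℝ) 1, |τ ^ (N - 1) * g (r * τ)| ≤ B := by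
  have key : ∀ τ ∈ uIoc (0 : ℝ) 1, |τ ^ (N - 1) * g (r * τ)| ≤ B := by
    intro τ hτ
    rw [uIoc_of_le zero_le_one] at hτ
    have h1 : |r * τ| ≤ |r| := by
      rw [abs_mul, abs_of_nonneg hτ.1.le]
      exact mul_le_of_le_one_right (abs_nonneg r) hτ.2
    have h2 : |τ ^ (N - 1)| ≤ 1 := by
      rw [abs_of_nonneg (pow_nonneg hτ.1.le _)]
      exact pow_le_one₀ hτ.1.le hτ.2
    rw [abs_mul]
    exact (mul_le_mul h2 (hB _ h1) (abs_nonneg _) zero_le_one).trans_eq (one_mul B)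
  refine ⟨?_, key⟩
  simpa [radialMean] using intervalIntegral.norm_integral_le_of_norm_le_const
    (f := fun τ => τ ^ (N - 1) * g (r * τ)) key

/-- Passage to the limit in `radialLift` under a locally uniform bound. -/
theorem tendsto_radialLift {G : ℕ → ℝ → ℝ} (hG : ∀ n, Continuous (G n))
    (hlim : ∀ r, Tendsto (fun n => G n r) atTop (𝓝 (g r)))
    {r B : ℝ} (hB : ∀ n s, |s| ≤ |r| → |G n s| ≤ B) :
    Tendsto (fun n => radialLift N a (G n) r) atTop (𝓝 (radialLift N a g r)) := by
  have hmean : ∀ s, |s| ≤ |r| →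
      Tendsto (fun n => radialMean N (G n) s) atTop (𝓝 (radialMean N g s)) := by
    intro s hs
    refine intervalIntegral.tendsto_integral_filter_of_dominated_convergence (fun _ => B)
      (.of_forall fun n => ?_) (.of_forall fun n => .of_forall
        (abs_radialMean_le fun t ht => hB n t (ht.trans hs)).2)
      intervalIntegrable_const (.of_forall fun τ _ => (hlim _).const_mul _)
    have := hG n
    exact Continuous.aestronglyMeasurable (by fun_prop)
  have habs : ∀ s ∈ uIoc 0 r, |s| ≤ |r| := by
    intro s hs
    rcases le_total 0 r with h | h
    · rw [uIoc_of_le h] at hs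
      rw [abs_of_nonneg h, abs_of_pos hs.1]
      exact hs.2
    · rw [uIoc_of_ge h] at hs
      rw [abs_of_nonpos h, abs_of_nonpos hs.2]
      exact neg_le_neg hs.1.le
  refine (intervalIntegral.tendsto_integral_filter_of_dominated_convergence (fun _ => |r| * B)
      (.of_forall fun n => ?_) (.of_forall fun n => .of_forall fun s hs => ?_)
      intervalIntegrable_const (.of_forall fun s hs => (hmean s (habs s hs)).const_mul _)).const_add a
  · exact (continuous_id.mul (continuous_radialMean N (hG n))).aestronglyMeasurable
  · rw [norm_mul]
    exact mul_le_mul (habs s hs)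
      (abs_radialMean_le fun t ht => hB n t (ht.trans (habs s hs))).1 (norm_nonneg _) (abs_nonneg _)

end RadialMean

/-! ### Energy estimate and divergence of the travel time. -/

/-- The time `∫ₐˢ dσ / √(2F(σ))` that the solution of `w' = √(2F(w))` needs to go from `a` to `s`. -/
noncomputable def travelTime (h : ℝ → ℝ) (a s : ℝ) : ℝ :=
  ∫ σ in a..s, 1 / √(2 * primitive h σ)

section TravelTime

variable {h : ℝ → ℝ} {a : ℝ}

theorem hasDerivAt_primitive (hh : Continuous h) (s : ℝ) : HasDerivAt (primitive h) (h s) s :=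
  (hh.integral_hasStrictDerivAt 0 s).hasDerivAt

theorem continuous_primitive (hh : Continuous h) : Continuous (primitive h) :=
  continuous_iff_continuousAt.2 fun s => (hasDerivAt_primitive hh s).continuousAt

theorem primitive_pos (hh : Continuous h) (hpos : ∀ s, 0 < s → 0 < h s) {s : ℝ} (hs : 0 < s) :
    0 < primitive h s :=
  intervalIntegral.intervalIntegral_pos_of_pos_on (hh.intervalIntegrable _ _)
    (fun x hx => hpos x hx.1) hs

theorem continuousOn_inv_sqrt_primitive (hh : Continuous h) (hpos : ∀ s, 0 < s → 0 < h s) :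
    ContinuousOn (fun s => 1 / √(2 * primitive h s)) (Ioi 0) := by
  have := continuous_primitive hh
  refine ContinuousOn.div continuousOn_const (by fun_prop) fun s hs => ?_
  have := primitive_pos hh hpos hs
  positivity

theorem intervalIntegrable_inv_sqrt_primitive (hh : Continuous h)
    (hpos : ∀ s, 0 < s → 0 < h s) {s t : ℝ} (hs : 0 < s) (ht : 0 < t) :
    IntervalIntegrable (fun s => 1 / √(2 * primitive h s)) volume s t :=
  ((continuousOn_inv_sqrt_primitive hh hpos).mono fun _ hx =>
    (lt_min hs ht).trans_le hx.1).intervalIntegrable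

theorem hasDerivAt_travelTime (hh : Continuous h) (hpos : ∀ s, 0 < s → 0 < h s) (ha : 0 < a)
    {s : ℝ} (hs : 0 < s) : HasDerivAt (travelTime h a) (1 / √(2 * primitive h s)) s := by
  have hm : Measurable fun s => 1 / √(2 * primitive h s) := by
    have := (continuous_primitive hh).measurable
    fun_prop
  exact intervalIntegral.integral_hasDerivAt_right
    (intervalIntegrable_inv_sqrt_primitive hh hpos ha hs)
    hm.stronglyMeasurable.stronglyMeasurableAtFilter
    ((continuousOn_inv_sqrt_primitive hh hpos).continuousAt (Ioi_mem_nhds hs))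

theorem travelTime_mono (hh : Continuous h) (hpos : ∀ s, 0 < s → 0 < h s) (ha : 0 < a)
    {s t : ℝ} (hs : 0 < s) (hst : s ≤ t) : travelTime h a s ≤ travelTime h a t := by
  have h1 := intervalIntegral.integral_add_adjacent_intervals
    (intervalIntegrable_inv_sqrt_primitive hh hpos ha hs)
    (intervalIntegrable_inv_sqrt_primitive hh hpos hs (hs.trans_le hst))
  rw [travelTime, travelTime, ← h1]
  exact le_add_of_nonneg_right (intervalIntegral.integral_nonneg hst fun _ _ => by positivity)

/-- The energy estimate `w'² ≤ 2F(w)` in integrated form. -/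
theorem travelTime_le {w p q : ℝ → ℝ} (hh : Continuous h) (hpos : ∀ s, 0 < s → 0 < h s)
    (ha : 0 < a) (hw0 : w 0 = a) (hp0 : p 0 = 0)
    (hw : ∀ r, 0 ≤ r → HasDerivAt w (p r) r) (hp : ∀ r, 0 ≤ r → HasDerivAt p (q r) r)
    (hpn : ∀ r, 0 ≤ r → 0 ≤ p r) (hq : ∀ r, 0 ≤ r → q r ≤ h (w r)) {r : ℝ} (hr : 0 ≤ r) :
    travelTime h a (w r) ≤ r := by
  have mono : ∀ {φ φ' : ℝ → ℝ}, (∀ r, 0 ≤ r → HasDerivAt φ (φ' r) r) →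
      (∀ r, 0 ≤ r → 0 ≤ φ' r) → ∀ r, 0 ≤ r → φ 0 ≤ φ r := by
    intro φ φ' hφ hφ' r hr
    refine monotoneOn_of_deriv_nonneg (convex_Ici 0)
      (fun x hx => (hφ x hx).continuousAt.continuousWithinAt)
      (fun x hx => (hφ x (interior_subset hx)).differentiableAt.differentiableWithinAt)
      (fun x hx => ?_) self_mem_Ici hr hr
    rw [(hφ x (interior_subset hx)).deriv]
    exact hφ' x (interior_subset hx)
  have hwa : ∀ r, 0 ≤ r → a ≤ w r := fun r hr => hw0 ▸ mono hw hpn r hr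
  -- The energy 2F(w) - p² has derivative 2p(h(w) - q) ≥ 0 and starts at 2F(a) > 0.
  have hE : ∀ r, 0 ≤ r → p r ^ 2 ≤ 2 * primitive h (w r) := by
    intro r hr
    have h1 := mono (φ := fun r => 2 * primitive h (w r) - p r ^ 2)
      (φ' := fun r => 2 * (h (w r) * p r) - 2 * p r * q r)
      (fun s hs => by
        refine ((((hasDerivAt_primitive hh (w s)).comp s (hw s hs)).const_mul 2).sub
          ((hp s hs).pow 2)).congr_deriv ?_
        norm_num)
      (fun s hs => by nlinarith [hpn s hs, hq s hs, mul_nonneg (hpn s hs) (sub_nonneg.2 (hq s hs))])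
      r hr
    simp only [hw0, hp0] at h1
    have := primitive_pos hh hpos ha
    linarith
  have h2 := mono (φ := fun r => r - travelTime h a (w r))
    (φ' := fun r => 1 - 1 / √(2 * primitive h (w r)) * p r)
    (fun s hs => (hasDerivAt_id s).sub ((hasDerivAt_travelTime hh hpos ha
      (ha.trans_le (hwa s hs))).comp s (hw s hs)))
    (fun s hs => by
      have h3 : 0 < √(2 * primitive h (w s)) :=
        Real.sqrt_pos.2 (mul_pos two_pos (primitive_pos hh hpos (ha.trans_le (hwa s hs))))
      rw [sub_nonneg, div_mul_eq_mul_div, one_mul, div_le_one h3]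
      exact Real.le_sqrt_of_sq_le (hE s hs)) r hr
  simp only [hw0, travelTime, intervalIntegral.integral_same, sub_zero] at h2
  exact sub_nonneg.1 h2

/-- A bounded travel time would make 1/√(2F), hence 1/√F, integrable on (1,∞). -/
theorem exists_lt_travelTime (hh : Continuous h) (hpos : ∀ s, 0 < s → 0 < h s)
    (hKO : KellerOssermanDiverges h) (ha : 0 < a) (R : ℝ) :
    ∃ M, a ≤ M ∧ R < travelTime h a M := by
  by_contra! hcon
  have hI : IntegrableOn (fun s => 1 / √(2 * primitive h s)) (Ioi 1) := by
    refine integrableOn_Ioi_of_intervalIntegral_norm_bounded (l := atTop)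
      (b := fun n : ℕ => (n : ℝ)) (travelTime h 1 a + R) 1 (fun n => ?_)
      tendsto_natCast_atTop_atTop ?_
    · rcases le_total (1 : ℝ) n with hn | hn
      · rw [← intervalIntegrable_iff_integrableOn_Ioc_of_le hn]
        exact intervalIntegrable_inv_sqrt_primitive hh hpos one_pos (by linarith)
      · simp [Ioc_eq_empty_of_le hn]
    · filter_upwards [tendsto_natCast_atTop_atTop.eventually_ge_atTop (max a 1)] with n hn
      have hn0 : (0 : ℝ) < n := one_pos.trans_le ((le_max_right a 1).trans hn)
      have h1 : ∀ s, ‖1 / √(2 * primitive h s)‖ = 1 / √(2 * primitive h s) := fun s =>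
        Real.norm_of_nonneg (by positivity)
      simp only [h1]
      rw [← intervalIntegral.integral_add_adjacent_intervals
        (intervalIntegrable_inv_sqrt_primitive hh hpos one_pos ha)
        (intervalIntegrable_inv_sqrt_primitive hh hpos ha hn0)]
      exact add_le_add_right (hcon n ((le_max_left a 1).trans hn)) _
  have h2 : (fun s => 1 / √(primitive h s)) = fun s => √2 * (1 / √(2 * primitive h s)) := by
    ext s
    rw [Real.sqrt_mul zero_le_two]
    have : √(2 : ℝ) ≠ 0 := by positivity
    rcases eq_or_ne (√(primitive h s)) 0 with h0 | h0
    · simp [h0]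
    · field_simp
  have h3 : IntegrableOn (fun s => 1 / √(primitive h s)) (Ioi 1) := h2 ▸ hI.const_mul _
  exact h3.lintegral_lt_top.ne hKO

/-- The travel time from `a` to a fixed `η` is unbounded as `a → 0`. -/
theorem exists_pos_lt_travelTime (hh : Continuous h) (hmono : Monotone h)
    (hpos : ∀ s, 0 < s → 0 < h s) (hlip : MonotoneOn (fun s => h s / s) (Ioi 0)) {η : ℝ}
    (hη : 0 < η) (R : ℝ) : ∃ a, 0 < a ∧ R < travelTime h a η := by
  set c := √(2 * (h η / η)) with hc
  have hc0 : 0 < c := Real.sqrt_pos.2 (mul_pos two_pos (div_pos (hpos η hη) hη))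
  -- Chosen so that c⁻¹ log(η/a) = |R| + 1.
  set a := η * Real.exp (-(c * (|R| + 1))) with ha
  have ha0 : 0 < a := by positivity
  have haη : a ≤ η := mul_le_of_le_one_right hη.le
    (Real.exp_le_one_iff.2 (neg_nonpos.2 (by positivity)))
  refine ⟨a, ha0, ?_⟩
  -- F(s) ≤ s h(s) ≤ (h(η)/η) s², so the integrand is at least 1/(cs) and the travel time diverges
  -- logarithmically.
  have hF : ∀ s, 0 < s → s ≤ η → √(2 * primitive h s) ≤ c * s := by
    intro s hs hsη
    have h1 : primitive h s ≤ h s * s := by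
      have := intervalIntegral.integral_mono_on hs.le (hh.intervalIntegrable (μ := volume) 0 s)
        intervalIntegrable_const (g := fun _ => h s) (fun x hx => hmono hx.2)
      simpa [primitive, mul_comm] using this
    have h2 : h s / s ≤ h η / η := hlip hs hη hsη
    have h3 : h s * s ≤ h η / η * s ^ 2 := by
      rw [div_le_iff₀ hs] at h2
      nlinarith
    rw [← Real.sqrt_sq hs.le, hc, ← Real.sqrt_mul (by positivity [hpos η hη])]
    rw [Real.sqrt_sq hs.le]
    exact Real.sqrt_le_sqrt (by linarith)
  have h4 : ∫ s in a..η, c⁻¹ * (1 / s) ≤ travelTime h a η := by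
    refine intervalIntegral.integral_mono_on haη ?_
      (intervalIntegrable_inv_sqrt_primitive hh hpos ha0 hη) fun s hs => ?_
    · refine (ContinuousOn.intervalIntegrable fun s hs => ?_)
      have : s ≠ 0 := ((lt_min ha0 hη).trans_le hs.1).ne'
      exact ContinuousAt.continuousWithinAt (by fun_prop (disch := assumption))
    · have hs0 := ha0.trans_le hs.1
      rw [← one_div, div_mul_div_comm, one_mul]
      exact one_div_le_one_div_of_le
        (Real.sqrt_pos.2 (mul_pos two_pos (primitive_pos hh hpos hs0))) (hF s hs0 hs.2)
  rw [intervalIntegral.integral_const_mul, integral_one_div_of_pos ha0 hη, ha,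
    div_mul_cancel_left₀ hη.ne', ← Real.exp_neg, neg_neg, Real.log_exp,
    inv_mul_cancel_left₀ hc0.ne'] at h4
  linarith [le_abs_self R]

end TravelTime

/-! ### Existence of radial stationary solutions. -/

/-- The monotone iteration for the radial equation `Δw = h(w)`, `w(0) = a`. -/
noncomputable def radialIter (N : ℕ) (h : ℝ → ℝ) (a : ℝ) : ℕ → ℝ → ℝ
  | 0 => fun _ => a
  | n + 1 => radialLift N a (h ∘ radialIter N h a n)

section RadialIter

variable {N : ℕ} {h : ℝ → ℝ} {a : ℝ}

theorem continuous_radialIter (hh : Continuous h) (n : ℕ) : Continuous (radialIter N h a n) := by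
  induction n with
  | zero => exact continuous_const
  | succ n ih => exact continuous_radialLift (hh.comp ih)

theorem radialIter_neg (n : ℕ) (r : ℝ) : radialIter N h a n (-r) = radialIter N h a n r := by
  induction n generalizing r with
  | zero => rfl
  | succ n ih => exact radialLift_neg (g := h ∘ radialIter N h a n) (fun s => congrArg h (ih s)) r

/-- Evenness carries comparisons proved for r ≥ 0 to the whole line. -/
theorem radialIter_abs (n : ℕ) (r : ℝ) : radialIter N h a n |r| = radialIter N h a n r := by
  rcases abs_choice r with hr | hr <;> rw [hr]
  exact radialIter_neg n r

theorem le_radialIter (h0 : 0 ≤ h) (n : ℕ) (r : ℝ) : a ≤ radialIter N h a n r := by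
  rw [← radialIter_abs]
  cases n with
  | zero => exact le_rfl
  | succ n => exact le_radialLift (g := h ∘ radialIter N h a n) (fun x => h0 (radialIter N h a n x)) (abs_nonneg r)

theorem radialIter_le_succ (hh : Continuous h) (hmono : Monotone h) (h0 : 0 ≤ h) (n : ℕ) :
    radialIter N h a n ≤ radialIter N h a (n + 1) := by
  induction n with
  | zero => exact fun r => le_radialIter h0 1 r
  | succ n ih =>
    intro r
    rw [← radialIter_abs, ← radialIter_abs (n + 1 + 1)]
    exact radialLift_mono (hh.comp (continuous_radialIter hh n))
      (hh.comp (continuous_radialIter hh (n + 1))) (fun s => hmono (ih s)) (abs_nonneg r)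

/-- The first-order term has a favourable sign, so the lift w satisfies w'' ≤ h(z) ≤ h(w). Assuming
only z ≤ w covers both the iterates and the fixed point. -/
theorem travelTime_radialLift_le (hN : 1 ≤ N) (hh : Continuous h) (hmono : Monotone h)
    (h0 : 0 ≤ h) (hpos : ∀ s, 0 < s → 0 < h s) (ha : 0 < a) {z : ℝ → ℝ} (hz : Continuous z)
    (hle : z ≤ radialLift N a (h ∘ z)) {r : ℝ} (hr : 0 ≤ r) :
    travelTime h a (radialLift N a (h ∘ z) r) ≤ r := by
  have hg : Continuous (h ∘ z) := hh.comp hz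
  have hnn : ∀ r, 0 ≤ radialMean N (h ∘ z) r := radialMean_nonneg fun r => h0 (z r)
  refine travelTime_le (p := fun r => r * radialMean N (h ∘ z) r) hh hpos ha radialLift_zero (zero_mul _)
    (fun r _ => hasDerivAt_radialLift hg r) (fun r _ => hasDerivAt_mul_radialMean hN hg r)
    (fun r hr => mul_nonneg hr (hnn r)) (fun r _ => ?_) hr
  have h1 : (1 : ℝ) ≤ N := by exact_mod_cast hN
  have h2 : (h ∘ z) r ≤ h (radialLift N a (h ∘ z) r) := hmono (hle r)
  nlinarith [hnn r]

theorem travelTime_radialIter_le (hN : 1 ≤ N) (hh : Continuous h) (hmono : Monotone h)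
    (h0 : 0 ≤ h) (hpos : ∀ s, 0 < s → 0 < h s) (ha : 0 < a) (n : ℕ) {r : ℝ} (hr : 0 ≤ r) :
    travelTime h a (radialIter N h a n r) ≤ r := by
  cases n with
  | zero => simpa [radialIter, travelTime] using hr
  | succ n =>
    exact travelTime_radialLift_le hN hh hmono h0 hpos ha
      (continuous_radialIter hh n) (radialIter_le_succ hh hmono h0 n) hr

theorem exists_radialIter_le (hN : 1 ≤ N) (hh : Continuous h) (hmono : Monotone h)
    (h0 : 0 ≤ h) (hpos : ∀ s, 0 < s → 0 < h s) (hKO : KellerOssermanDiverges h) (ha : 0 < a)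
    (R : ℝ) : ∃ M, ∀ n r, |r| ≤ R → radialIter N h a n r ≤ M := by
  obtain ⟨M, haM, hM⟩ := exists_lt_travelTime hh hpos hKO ha R
  refine ⟨M, fun n r hr => ?_⟩
  by_contra! hlt
  rw [← radialIter_abs] at hlt
  have h1 := travelTime_mono hh hpos ha (ha.trans_le haM) hlt.le
  have h2 := travelTime_radialIter_le hN hh hmono h0 hpos ha n (abs_nonneg r)
  linarith

/-- Global existence of radial solutions of `Δw = h(w)` under the Keller–Osserman condition. -/
theorem exists_radialLift_fixedPoint (hN : 1 ≤ N) (hh : Continuous h) (hmono : Monotone h)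
    (h0 : 0 ≤ h) (hpos : ∀ s, 0 < s → 0 < h s) (hKO : KellerOssermanDiverges h) (ha : 0 < a) :
    ∃ w : ℝ → ℝ, Continuous w ∧ (∀ r, a ≤ w r) ∧ w = radialLift N a (h ∘ w) := by
  have hbd := exists_radialIter_le hN hh hmono h0 hpos hKO ha
  set w : ℝ → ℝ := fun r => ⨆ n, radialIter N h a n r with hw
  have hlim : ∀ r, Tendsto (fun n => radialIter N h a n r) atTop (𝓝 (w r)) := by
    intro r
    obtain ⟨M, hM⟩ := hbd |r|
    refine tendsto_atTop_ciSup (monotone_nat_of_le_succ fun n => radialIter_le_succ hh hmono h0 n r)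
      ⟨M, ?_⟩
    rintro _ ⟨n, rfl⟩
    exact hM n r le_rfl
  have hbound : ∀ R, ∃ B, ∀ n s, |s| ≤ R → |(h ∘ radialIter N h a n) s| ≤ B := by
    intro R
    obtain ⟨M, hM⟩ := hbd R
    refine ⟨h M, fun n s hs => ?_⟩
    rw [Function.comp_apply, abs_of_nonneg (h0 _)]
    exact hmono (hM n s hs)
  have hcont : Continuous w := by
    rw [continuous_iff_continuousAt]
    intro r₀
    set R := |r₀| + 1 with hR
    obtain ⟨B, hB⟩ := hbound R
    -- The iterates are equi-Lipschitz on compact sets, so their supremum is continuous.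
    have hlip : ∀ n, ∀ x ∈ Icc (-R) R, ∀ y ∈ Icc (-R) R,
        ‖radialIter N h a (n + 1) y - radialIter N h a (n + 1) x‖ ≤ R * B * ‖y - x‖ := by
      intro n x hx y hy
      refine (convex_Icc (-R) R).norm_image_sub_le_of_norm_hasDerivWithin_le
        (fun s _ => (hasDerivAt_radialLift
          (hh.comp (continuous_radialIter hh n)) s).hasDerivWithinAt) (fun s hs => ?_) hx hy
      have hs' : |s| ≤ R := abs_le.2 hs
      rw [norm_mul]
      exact mul_le_mul hs' (abs_radialMean_le fun t ht => hB n t (ht.trans hs')).1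
        (norm_nonneg _) (by positivity)
    have hlipw : ∀ x ∈ Icc (-R) R, ∀ y ∈ Icc (-R) R, dist (w x) (w y) ≤ R * B * dist x y := by
      intro x hx y hy
      have h1 := fun r => (tendsto_add_atTop_iff_nat 1).2 (hlim r)
      exact le_of_tendsto ((h1 x).sub (h1 y)).norm (.of_forall fun n => hlip n y hy x hx)
    have hB0 : 0 ≤ R * B := by
      have := (abs_nonneg _).trans (hB 0 0 (by simp only [abs_zero]; positivity))
      positivity
    have hcw : ContinuousOn w (Icc (-R) R) :=
      (LipschitzOnWith.of_dist_le_mul (K := ⟨R * B, hB0⟩) hlipw).continuousOn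
    exact hcw.continuousAt (Icc_mem_nhds (by linarith [neg_abs_le r₀]) (by linarith [le_abs_self r₀]))
  refine ⟨w, hcont, fun r => ge_of_tendsto (hlim r) (.of_forall fun n => le_radialIter h0 n r), ?_⟩
  ext r
  obtain ⟨B, hB⟩ := hbound |r|
  refine tendsto_nhds_unique ((tendsto_add_atTop_iff_nat 1).2 (hlim r)) ?_
  exact tendsto_radialLift (fun n => hh.comp (continuous_radialIter hh n))
    (fun s => (hh.tendsto _).comp (hlim s)) hB

end RadialIter

theorem isRadialSolution_of_eq_radialLift {N : ℕ} {f h w : ℝ → ℝ} {a : ℝ} (hN : 1 ≤ N)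
    (hh : Continuous h) (hfh : ∀ s, 0 ≤ s → f s = h s) (ha : 0 < a) (hw : Continuous w)
    (hwa : ∀ r, a ≤ w r) (hfix : w = radialLift N a (h ∘ w)) : IsRadialSolution N f a w := by
  have hg : Continuous (h ∘ w) := hh.comp hw
  have hd : ∀ r, HasDerivAt w (r * radialMean N (h ∘ w) r) r := fun r => by
    conv => arg 1; rw [hfix]
    exact hasDerivAt_radialLift hg r
  have hdd : deriv w = fun r => r * radialMean N (h ∘ w) r := funext fun r => (hd r).deriv
  refine ⟨?_, fun r _ => ha.trans_le (hwa r), fun r hr => ?_, ?_, ?_⟩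
  · rw [hfix]
    exact (contDiff_radialLift hN hg).contDiffOn
  · rw [hdd, (hasDerivAt_mul_radialMean hN hg r).deriv, hfh _ (ha.le.trans (hwa r))]
    simp only [Function.comp_apply]
    field_simp
    ring
  · rw [(hd 0).hasDerivWithinAt.derivWithin (uniqueDiffOn_Ici 0 0 self_mem_Ici), zero_mul]
  · rw [hfix, radialLift_zero]

/-! ### Second-order conditions and the Laplacian of radial functions. -/

theorem IsLocalMax.deriv_deriv_nonpos {φ : ℝ → ℝ} {x : ℝ} (hmax : IsLocalMax φ x)
    (hc : ContinuousAt φ x) : deriv (deriv φ) x ≤ 0 := by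
  by_contra! hpos
  -- A positive second derivative would make x a local minimum too, so φ would be locally constant.
  have hmin := isLocalMin_of_deriv_deriv_pos hpos hmax.deriv_eq_zero hc
  have hconst : φ =ᶠ[𝓝 x] fun _ => φ x := by
    filter_upwards [hmax, hmin] with y h1 h2 using le_antisymm h1 h2
  have h1 : deriv φ =ᶠ[𝓝 x] fun _ => 0 := by
    simpa using hconst.deriv
  simp [h1.deriv_eq] at hpos

section Radial

variable {N : ℕ} {E : Type*} [NormedAddCommGroup E] [InnerProductSpace ℝ E] {g : ℝ → ℝ} {a : ℝ}

theorem hasFDerivAt_norm_of_ne_zero {y : E} (hy : y ≠ 0) :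
    HasFDerivAt (fun y : E => ‖y‖) (‖y‖⁻¹ • innerSL ℝ y) y := by
  have hy0 : ‖y‖ ≠ 0 := norm_ne_zero_iff.2 hy
  have h1 := (hasStrictFDerivAt_norm_sq y).hasFDerivAt.sqrt (pow_ne_zero 2 hy0)
  simp only [Real.sqrt_sq (norm_nonneg _)] at h1
  refine h1.congr_fderiv ?_
  ext v
  simp
  field_simp

theorem hasDerivAt_line (x e : E) (t : ℝ) : HasDerivAt (fun t : ℝ => x + t • e) e t := by
  simpa using ((hasDerivAt_id t).smul_const e).const_add x

theorem hasFDerivAt_radialLift_norm (hg : Continuous g) (y : E) :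
    HasFDerivAt (fun y : E => radialLift N a g ‖y‖) (radialMean N g ‖y‖ • innerSL ℝ y) y := by
  rcases eq_or_ne y 0 with rfl | hy
  · have h1 := (hasDerivAt_iff_isLittleO.1 (hasDerivAt_radialLift (N := N) (a := a) hg 0)).comp_tendsto
      (tendsto_norm_zero (E := E))
    rw [hasFDerivAt_iff_isLittleO]
    refine (h1.congr (fun y => ?_) (fun y => ?_)).of_norm_right
    · simp
    · simp
  · refine ((hasDerivAt_radialLift hg ‖y‖).comp_hasFDerivAt y
      (hasFDerivAt_norm_of_ne_zero hy)).congr_fderiv ?_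
    have : ‖y‖ ≠ 0 := norm_ne_zero_iff.2 hy
    rw [smul_smul]
    congr 1
    field_simp

/-- This is the second directional derivative of the radial lift. At x = 0 the quotient term
vanishes. -/
theorem hasDerivAt_radialMean_mul_inner (hN : 1 ≤ N) (hg : Continuous g) (x : E) {e : E}
    (he : ‖e‖ = 1) :
    HasDerivAt (fun t : ℝ => radialMean N g ‖x + t • e‖ * inner ℝ (x + t • e) e)
      (radialMean N g ‖x‖ + (g ‖x‖ - N * radialMean N g ‖x‖) / ‖x‖ ^ 2 * inner ℝ e x ^ 2) 0 := by
  have hin : HasDerivAt (fun t : ℝ => inner ℝ (x + t • e) e) 1 0 := by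
    simpa [he] using (hasDerivAt_line x e 0).inner ℝ (hasDerivAt_const 0 e)
  have hAc := continuous_radialMean N hg
  rcases eq_or_ne x 0 with rfl | hx
  · have h1 : Continuous fun t : ℝ => radialMean N g ‖(0 : E) + t • e‖ := by fun_prop
    rw [hasDerivAt_iff_tendsto_slope]
    have h2 := (h1.tendsto 0).mono_left (nhdsWithin_le_nhds (s := {0}ᶜ))
    simp only [inner_zero_right, norm_zero, zero_smul, add_zero, ne_eq, OfNat.ofNat_ne_zero,
      not_false_eq_true, zero_pow, mul_zero] at h2 ⊢
    refine h2.congr' ?_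
    filter_upwards [self_mem_nhdsWithin] with t ht
    have ht' : t ≠ 0 := ht
    simp [slope_def_field, inner_smul_left, he]
    field_simp
  · have hx0 : ‖x‖ ≠ 0 := norm_ne_zero_iff.2 hx
    have h1 : HasFDerivAt (fun y : E => radialMean N g ‖y‖)
        (((g ‖x‖ - N * radialMean N g ‖x‖) / ‖x‖) • (‖x‖⁻¹ • innerSL ℝ x))
        (x + (0 : ℝ) • e) := by
      rw [zero_smul, add_zero]
      exact (hasDerivAt_radialMean hN hg hx0).comp_hasFDerivAt x (hasFDerivAt_norm_of_ne_zero hx)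
    have h2 : HasDerivAt (fun t : ℝ => radialMean N g ‖x + t • e‖)
        ((((g ‖x‖ - N * radialMean N g ‖x‖) / ‖x‖) • (‖x‖⁻¹ • innerSL ℝ x)) e) 0 := by
      have h3 := h1.comp_hasDerivAt (0 : ℝ) (hasDerivAt_line x e 0)
      exact h3
    refine (h2.mul hin).congr_deriv ?_
    simp [real_inner_comm]
    field_simp
    ring

end Radial

/-- At a spatial maximum of `z - w(|x|)` the Laplacian of `z` is at most that of `w(|x|)`. -/
theorem laplacian_le_of_isLocalMax {N : ℕ} {g : ℝ → ℝ} {z : Space N → ℝ} {x : Space N} {a : ℝ}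
    (hN : 1 ≤ N) (hg : Continuous g) (hz : ContDiff ℝ 2 z)
    (hmax : IsLocalMax (fun y => z y - radialLift N a g ‖y‖) x) : Δ z x ≤ g ‖x‖ := by
  have hzd : ∀ y, HasFDerivAt z (fderiv ℝ z y) y := fun y =>
    (hz.differentiable (by norm_num) y).hasFDerivAt
  have hzdd : HasFDerivAt (fderiv ℝ z) (fderiv ℝ (fderiv ℝ z) x) x :=
    ((hz.fderiv_right (m := 1) (by norm_num)).differentiable (by norm_num) x).hasFDerivAt
  have hdir : ∀ e : Space N, ‖e‖ = 1 → fderiv ℝ (fderiv ℝ z) x e e ≤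
      radialMean N g ‖x‖ + (g ‖x‖ - N * radialMean N g ‖x‖) / ‖x‖ ^ 2 * inner ℝ e x ^ 2 := by
    intro e he
    have hd : ∀ t : ℝ, HasDerivAt (fun t : ℝ => z (x + t • e) - radialLift N a g ‖x + t • e‖)
        (fderiv ℝ z (x + t • e) e - radialMean N g ‖x + t • e‖ * inner ℝ (x + t • e) e) t :=
      fun t => ((hzd _).comp_hasDerivAt t (hasDerivAt_line x e t)).sub
        ((hasFDerivAt_radialLift_norm hg _).comp_hasDerivAt t (hasDerivAt_line x e t))
    have hzdd0 : HasFDerivAt (fderiv ℝ z) (fderiv ℝ (fderiv ℝ z) x) (x + (0 : ℝ) • e) := by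
      rwa [zero_smul, add_zero]
    have h3 : HasDerivAt (fun t : ℝ => fderiv ℝ z (x + t • e)) (fderiv ℝ (fderiv ℝ z) x e) 0 :=
      hzdd0.comp_hasDerivAt 0 (hasDerivAt_line x e 0)
    have h4 : HasDerivAt (fun t : ℝ => fderiv ℝ z (x + t • e) e)
        (fderiv ℝ (fderiv ℝ z) x e e) 0 := by
      simpa using h3.clm_apply (hasDerivAt_const 0 e)
    have hlm : IsLocalMax (fun t : ℝ => z (x + t • e) - radialLift N a g ‖x + t • e‖) 0 := by
      have hc : Tendsto (fun t : ℝ => x + t • e) (𝓝 0) (𝓝 x) := by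
        have := (hasDerivAt_line x e 0).continuousAt.tendsto
        rwa [zero_smul, add_zero] at this
      have := hc.eventually hmax
      simpa [IsLocalMax, IsMaxFilter] using this
    have h1 := hlm.deriv_deriv_nonpos (hd 0).continuousAt
    rw [funext fun t => (hd t).deriv,
      (h4.fun_sub (hasDerivAt_radialMean_mul_inner hN hg x he)).deriv] at h1
    linarith
  set b := EuclideanSpace.basisFun (Fin N) ℝ
  rw [InnerProductSpace.laplacian_eq_iteratedFDeriv_orthonormalBasis z b]
  simp only [iteratedFDeriv_two_apply, Matrix.cons_val_zero, Matrix.cons_val_one]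
  refine (Finset.sum_le_sum fun i _ => hdir (b i) (b.norm_eq_one i)).trans_eq ?_
  -- Summed over the basis, the bounds give N·mean + (g - N·mean) = g; at the origin N·mean = g
  -- already.
  rw [Finset.sum_add_distrib, ← Finset.mul_sum, b.sum_sq_inner_right]
  simp only [Finset.sum_const, Finset.card_univ, Fintype.card_fin, nsmul_eq_mul]
  rcases eq_or_ne x 0 with rfl | hx
  · have hN0 : (N : ℝ) ≠ 0 := by positivity
    rw [norm_zero, radialMean_zero hN]
    field_simp
    ring
  · have hx0 : ‖x‖ ≠ 0 := norm_ne_zero_iff.2 hx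
    field_simp
    ring

/-! ### Comparison and conclusion. -/

theorem ConditionC1.add_le {f : ℝ → ℝ} (hC1 : ConditionC1 f) {s t : ℝ} (hs : 0 < s) (ht : 0 < t) :
    f s + f t ≤ f (s + t) := by
  have h1 : f s / s ≤ f (s + t) / (s + t) :=
    hC1.monotoneOn hs (add_pos hs ht) (le_add_of_nonneg_right ht.le)
  have h2 : f t / t ≤ f (s + t) / (s + t) :=
    hC1.monotoneOn ht (add_pos hs ht) (le_add_of_nonneg_left hs.le)
  rw [div_le_iff₀ hs] at h1
  rw [div_le_iff₀ ht] at h2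
  have h3 : f (s + t) / (s + t) * (s + t) = f (s + t) := div_mul_cancel₀ _ (add_pos hs ht).ne'
  linarith

/-- One-sided because the maximum may occur at the final time. -/
theorem HasDerivAt.nonneg_of_forall_le_left {φ : ℝ → ℝ} {d s t : ℝ} (h : HasDerivAt φ d t)
    (hst : s < t) (hle : ∀ r ∈ Ioo s t, φ r ≤ φ t) : 0 ≤ d := by
  have h1 := (hasDerivWithinAt_iff_tendsto_slope' (s := Iio t) self_notMem_Iio).1
    h.hasDerivWithinAt
  refine ge_of_tendsto h1 ?_
  filter_upwards [Ioo_mem_nhdsLT hst] with r hr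
  rw [slope_def_field]
  exact div_nonneg_of_nonpos (sub_nonpos.2 (hle r hr)) (sub_nonpos.2 hr.2.le)

/-- The difference of two solutions stays below a radial stationary solution which dominates it
at infinity. -/
theorem sub_le_of_isLittleO {N : ℕ} {f h w : ℝ → ℝ} {a : ℝ} {u₀ : Space N → ℝ}
    {u v : Space N → ℝ → ℝ} (hN : 1 ≤ N) (hf : IsAbsorption f) (hC1 : ConditionC1 f)
    (hh : Continuous h) (hfh : ∀ s, 0 ≤ s → f s = h s) (ha : 0 < a) (hw : Continuous w)
    (hwa : ∀ r, a ≤ w r) (hfix : w = radialLift N a (h ∘ w))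
    (hu : IsPositiveSolution N f u₀ u) (hv : IsPositiveSolution N f u₀ v)
    (huv : IsLittleOLocallyUniformly N (fun x t => u x t - v x t) w)
    (x₀ : Space N) {t₀ : ℝ} (ht₀ : 0 ≤ t₀) : u x₀ t₀ - v x₀ t₀ ≤ w ‖x₀‖ := by
  have hwpos : ∀ r, 0 < w r := fun r => ha.trans_le (hwa r)
  have hinit : ∀ x, u x 0 - v x 0 = 0 := fun x => by rw [hu.initial, hv.initial, sub_self]
  rcases ht₀.eq_or_lt with rfl | ht₀
  · rw [hinit]
    exact (hwpos _).le
  by_contra! hlt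
  obtain ⟨R, hR⟩ := huv t₀ ht₀ 1 one_pos
  set R' := max R ‖x₀‖ + 1
  set d := u x₀ t₀ - v x₀ t₀ - w ‖x₀‖ with hd
  have hd0 : 0 < d := sub_pos.2 hlt
  -- The penalty ηt costs only d/2 at t₀, so the maximum stays positive, and it makes the time
  -- inequality strict.
  set η := d / (2 * t₀) with hη
  have hη0 : 0 < η := by positivity
  set K : Set (Space N × ℝ) := Metric.closedBall 0 R' ×ˢ Icc 0 t₀
  have hK : IsCompact K := (isCompact_closedBall 0 R').prod isCompact_Icc
  have hx₀K : (x₀, t₀) ∈ K := by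
    refine ⟨?_, ht₀.le, le_rfl⟩
    rw [mem_closedBall_zero_iff]
    exact (le_max_right R _).trans (le_add_of_nonneg_right zero_le_one)
  have hcont : ContinuousOn (fun p : Space N × ℝ => u p.1 p.2 - v p.1 p.2 - w ‖p.1‖ - η * p.2) K := by
    refine (((hu.continuousOn_closure.sub hv.continuousOn_closure).mono fun p hp => hp.2.1).sub
      ?_).sub ?_
    · exact Continuous.continuousOn (by fun_prop)
    · exact Continuous.continuousOn (by fun_prop)
  obtain ⟨⟨x₁, t₁⟩, hp, hmax⟩ := hK.exists_isMaxOn ⟨_, hx₀K⟩ hcont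
  have hval : 0 < u x₁ t₁ - v x₁ t₁ - w ‖x₁‖ - η * t₁ := by
    refine lt_of_lt_of_le ?_ (hmax hx₀K)
    have : η * t₀ = d / 2 := by rw [hη]; field_simp
    simp only [this, ← hd]
    linarith
  have ht₁ : 0 < t₁ := by
    refine hp.2.1.lt_of_ne ?_
    rintro rfl
    rw [hinit] at hval
    linarith [hwpos ‖x₁‖]
  have hz : w ‖x₁‖ < u x₁ t₁ - v x₁ t₁ := by
    have := mul_pos hη0 ht₁
    linarith
  have hx₁ : ‖x₁‖ < R' := by
    by_contra! hge
    have h1 : R ≤ ‖x₁‖ := ((le_max_left R ‖x₀‖).trans (le_add_of_nonneg_right zero_le_one)).trans hge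
    have h2 := hR x₁ h1 t₁ hp.2
    rw [one_mul, abs_of_pos (hwpos _)] at h2
    linarith [le_abs_self (u x₁ t₁ - v x₁ t₁)]
  have hcu := hu.isC21.contDiff_space t₁ ht₁
  have hcv := hv.isC21.contDiff_space t₁ ht₁
  have hspace : Δ (fun y => u y t₁) x₁ - Δ (fun y => v y t₁) x₁ ≤ h (w ‖x₁‖) := by
    rw [← hcu.contDiffAt.laplacian_sub hcv.contDiffAt]
    refine laplacian_le_of_isLocalMax (a := a) hN (hh.comp hw) (hcu.sub hcv) ?_
    rw [← hfix]
    filter_upwards [Metric.isOpen_ball.mem_nhds (mem_ball_zero_iff.2 hx₁)] with y hy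
    have := hmax (show (y, t₁) ∈ K from ⟨Metric.ball_subset_closedBall hy, hp.2⟩)
    simp only [mem_ofPred_eq] at this
    simp only [Pi.sub_apply]
    linarith
  have htime : 0 ≤ deriv (fun s => u x₁ s) t₁ - deriv (fun s => v x₁ s) t₁ - η := by
    have h1 := ((((hu.isC21.differentiableAt_time x₁ t₁ ht₁).hasDerivAt).fun_sub
      ((hv.isC21.differentiableAt_time x₁ t₁ ht₁).hasDerivAt)).sub_const (w ‖x₁‖)).fun_sub
      ((hasDerivAt_id' t₁).const_mul η)
    rw [mul_one] at h1
    exact h1.nonneg_of_forall_le_left ht₁ fun r hr =>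
      hmax (show (x₁, r) ∈ K from ⟨hp.1, hr.1.le, hr.2.le.trans hp.2.2⟩)
  have hnonlin : h (w ‖x₁‖) ≤ f (u x₁ t₁) - f (v x₁ t₁) := by
    have hzpos := (hwpos ‖x₁‖).trans hz
    have h1 := hC1.add_le (hv.pos x₁ t₁ ht₁) hzpos
    rw [add_sub_cancel] at h1
    rw [← hfh _ (hwpos _).le]
    have h2 : f (w ‖x₁‖) ≤ f (u x₁ t₁ - v x₁ t₁) :=
      hf.monotoneOn (hwpos ‖x₁‖).le hzpos.le hz.le
    linarith
  -- At the maximum, 0 < η ≤ ∂ₜ(u - v) = Δ(u - v) - (f(u) - f(v)) ≤ h(w) - h(w) = 0.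
  linarith [hu.equation x₁ t₁ ht₁, hv.equation x₁ t₁ ht₁]

theorem theorem1p7 (N : ℕ) (hN : 2 ≤ N) (f : ℝ → ℝ) (hf : IsAbsorption f)
    (hC1 : ConditionC1 f) (hKO : KellerOssermanDiverges f)
    (u₀ : Space N → ℝ) (u v : Space N → ℝ → ℝ)
    (hu : IsPositiveSolution N f u₀ u) (hv : IsPositiveSolution N f u₀ v)
    (huv : ∀ ε : ℝ, 0 < ε → ∀ w : ℝ → ℝ, IsRadialSolution N f ε w →
      IsLittleOLocallyUniformly N (fun x t => u x t - v x t) w) :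
    ∀ x t, 0 ≤ t → u x t = v x t := by
  have hN1 : 1 ≤ N := one_le_two.trans hN
  -- Extending f by 0 to negative arguments gives a continuous monotone function on the whole line.
  set h : ℝ → ℝ := fun s => f (max s 0) with hhdef
  have hfh : ∀ s, 0 ≤ s → f s = h s := fun s hs => by simp only [hhdef, max_eq_left hs]
  have hh : Continuous h :=
    hf.continuousOn.comp_continuous (by fun_prop) fun s => le_max_right s 0
  have hmono : Monotone h := fun s t hst =>
    hf.monotoneOn (le_max_right s 0) (le_max_right t 0) (max_le_max_right 0 hst)
  have hpos : ∀ s, 0 < s → 0 < h s := fun s hs => hfh s hs.le ▸ hf.pos s hs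
  have h0 : 0 ≤ h := fun s => by
    rcases (le_max_right s 0).eq_or_lt with hs | hs
    · simp only [hhdef, ← hs, hf.zero, Pi.zero_apply, le_refl]
    · exact (hf.pos _ hs).le
  have hlip : MonotoneOn (fun s => h s / s) (Ioi 0) :=
    hC1.monotoneOn.congr fun s hs => by simp only [hfh s (le_of_lt hs)]
  have hKO' : KellerOssermanDiverges h := by
    rw [KellerOssermanDiverges, ← hKO]
    refine setLIntegral_congr_fun measurableSet_Ioi fun s hs => ?_
    have hs0 : (0 : ℝ) ≤ s := zero_le_one.trans (le_of_lt hs)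
    have : primitive h s = primitive f s := by
      refine intervalIntegral.integral_congr fun σ hσ => ?_
      rw [uIcc_of_le hs0] at hσ
      exact (hfh σ hσ.1).symm
    simp only [this]
  intro x t ht
  refine eq_of_abs_sub_nonpos (le_of_forall_pos_le_add fun η hη => ?_)
  rw [zero_add]
  obtain ⟨a, ha, hlt⟩ := exists_pos_lt_travelTime hh hmono hpos hlip hη ‖x‖
  obtain ⟨w, hw, hwa, hfix⟩ := exists_radialLift_fixedPoint hN1 hh hmono h0 hpos hKO' ha
  have hoV := huv a ha w (isRadialSolution_of_eq_radialLift hN1 hh hfh ha hw hwa hfix)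
  have hoU : IsLittleOLocallyUniformly N (fun x t => v x t - u x t) w := by
    intro T hT δ hδ
    simpa only [abs_sub_comm] using hoV T hT δ hδ
  have hsmall : w ‖x‖ ≤ η := by
    by_contra! hηw
    have h1 := travelTime_radialLift_le hN1 hh hmono h0 hpos ha hw hfix.le (norm_nonneg x)
    rw [← hfix] at h1
    linarith [travelTime_mono hh hpos ha hη hηw.le]
  refine (abs_le'.2 ⟨?_, ?_⟩).trans hsmall
  · exact sub_le_of_isLittleO hN1 hf hC1 hh hfh ha hw hwa hfix hu hv hoV x ht
  · rw [neg_sub]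
    exact sub_le_of_isLittleO hN1 hf hC1 hh hfh ha hw hwa hfix hv hu hoU x ht
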